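/- Let $\Phi$ be a reduced crystallographic root system spanning a finite-dimensional $\mathbb{Q}$-vector space $V$, with Weyl group $W$ and set $S \subset W$ of simple reflections with respect to a fixed base of $\Phi$, so that $(W,S)$ is a finite Weyl group. Let $J \subseteq S$, and let $\lambda \in V$ be any dominant weight with $J=\{s\in S \mid s(\lambda)=\lambda\}$. Let $P_\lambda=\mathrm{Conv}(W\cdot\lambda)\subset V$, let $d=\dim P_\lambda$, and let $f_i$ be the number of $i$-dimensional (nonempty) faces of $P_\lambda$, including $P_\lambda$ itself for $i=d$. The $h$-polynomial of the projective toric variety $X(J)$ associated with the normal fan of $P_\lambda$ is by definition $$h(t)=\sum_{i=0}^{d} f_i\,(t-1)^i .$$ Regard $S$ as a graph in which $s$ and $t$ are joined by an edge if and only if $st\neq ts$, and put $$S(J)=\{I\subseteq S \mid \text{no connected component of the induced subgraph on } I \text{ is contained entirely in } J\}.$$ For $I\in S(J)$ put $I^*_J=I\cup\{s\in J \mid st=ts \text{ for all } t\in I\}$, and for $K\subseteq S$ let $W_K$ be the subgroup of $W$ generated by $K$. Then $$h(t)=\sum_{I\in S(J)}\frac{|W|}{|W_{I^*_J}|}\,(t-1)^{|I|}.$$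 -/

import Mathlib

noncomputable section

namespace WeylPolytope

/-! ### Face numbers and `h`-polynomials of convex polytopes -/

section Polytope

variable {V : Type*} [AddCommGroup V] [Module ℚ V]

/-- `F` is a (nonempty) face of the polytope `K`: the set of points of `K` at which some linear
functional attains its maximum over `K`. The zero functional gives `K` itself. -/
def IsFace (K F : Set V) : Prop :=
  F.Nonempty ∧ ∃ f : Module.Dual ℚ V, F = {x | x ∈ K ∧ ∀ y ∈ K, f y ≤ f x}

/-- The dimension of a nonempty convex set, that is, of its affine span. -/
def dim (F : Set V) : ℕ := Module.finrank ℚ (vectorSpan ℚ F)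

/-- The number `f_i` of `i`-dimensional faces of the polytope `K`. -/
def faceNumber (K : Set V) (i : ℕ) : ℕ := Set.ncard {F : Set V | IsFace K F ∧ dim F = i}

/-- The face polynomial `f(t) = ∑_{i=0}^d f_i t^i` of the `d`-dimensional polytope `K`. -/
def facePolynomial (K : Set V) : Polynomial ℚ :=
  ∑ i ∈ Finset.range (dim K + 1), Polynomial.C (faceNumber K i : ℚ) * Polynomial.X ^ i

/-- The `h`-polynomial `h(t) = f(t - 1)` of the polytope `K`. -/
def hPolynomial (K : Set V) : Polynomial ℚ :=
  (facePolynomial K).comp (Polynomial.X - 1)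

end Polytope

/-! ### The finite Weyl group `(W, S)` and the polytope of a weight -/

section Weyl

variable {ι M N : Type*} [AddCommGroup M] [Module ℚ M] [AddCommGroup N] [Module ℚ N]
  {P : RootPairing ι ℚ M N}

/-- The convex hull `P_λ` of the orbit `W λ` of the weight `lam` under the Weyl group. -/
def weightPolytope (P : RootPairing ι ℚ M N) (lam : M) : Set M :=
  convexHull ℚ (Set.range fun w : P.weylGroup => w • lam)

/-- The simple reflection in the Weyl group `W` attached to a node of the Dynkin diagram.
The set `S` of simple reflections is indexed by the nodes, that is by the simple roots. -/
def simpleReflection (b : P.Base) (s : b.support) : P.weylGroup :=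
  RootPairing.weylGroup.ofIdx P s

/-- A weight is dominant if its pairing with every simple coroot is nonnegative. -/
def IsDominant (b : P.Base) (lam : M) : Prop :=
  ∀ s : b.support, 0 ≤ P.toLinearMap lam (P.coroot s)

/-- The graph structure on `S`: `s` and `t` are joined by an edge if `s t ≠ t s`. -/
def diagram (b : P.Base) : SimpleGraph b.support where
  Adj s t := ¬ Commute (simpleReflection b s) (simpleReflection b t)
  symm := ⟨fun _ _ h hc => h hc.symm⟩
  loopless := ⟨fun _ h => h (Commute.refl _)⟩

/-- The parabolic subgroup `W_I` of `W` generated by the simple reflections in `I`. -/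
def parabolic (b : P.Base) (I : Finset b.support) : Subgroup P.weylGroup :=
  Subgroup.closure (simpleReflection b '' (I : Set b.support))

open Classical in
/-- `S(J)`: the sets `I ⊆ S` such that no connected component of `I` (as an induced subgraph of
the diagram) is contained entirely in `J`. -/
def admissible (b : P.Base) (J : Finset b.support) : Finset (Finset b.support) :=
  Finset.univ.filter fun I =>
    ∀ c : ((diagram b).induce (I : Set b.support)).ConnectedComponent,
      ¬ (∀ s ∈ c.supp, (s : b.support) ∈ J)

open Classical in
/-- `I*_J = I ∪ {s ∈ J | s t = t s for all t ∈ I}`. -/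
def star (b : P.Base) (J I : Finset b.support) : Finset b.support :=
  I ∪ J.filter fun s => ∀ t ∈ I, Commute (simpleReflection b s) (simpleReflection b t)

end Weyl

end WeylPolytope

end

open WeylPolytope Pointwise

/-! Faces are counted orbit by orbit under W. An invariant positive definite form turns every linear
functional into a vector, which W moves into the dominant chamber. For dominant x, the part of the
orbit of λ where x is maximal is the orbit of λ under W_K, with K the simple roots orthogonal to x.
So the faces are exactly the W-translates of the cells Conv(W_K λ) (`isFace_iff`).

Different K may give the same cell. Removing from K the part orthogonal both to λ and to the rest of
K leaves the cell unchanged and makes K admissible (`exists_isAdm`, `cell_eq_of_subset`). For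
admissible I the cell has dimension |I| (`dim_cell`), its stabilizer is the parabolic subgroup of
I*_J, and different I lie in different orbits; the last two facts come from
`mem_parab_closureSet_of_smul_cell_eq`. Orbit-stabilizer then gives the coefficients.

The Coxeter-theoretic input is the exchange condition and its consequence that the stabilizer of a
dominant vector is generated by simple reflections (`mem_parab_of_smul_eq`). All this uses only the
axioms of `SimpleSystem`; the Weyl group is shown to satisfy them at the end. -/

/-- A finite group `G` of isometries of a positive definite rational space `V`, generated by the
reflections in a basis of `V` indexed by `S`, together with a set of positive roots. -/
structure SimpleSystem (G V S : Type*) [Group G] [AddCommGroup V] [Module ℚ V]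
    [DistribMulAction G V] where
  basis : Module.Basis S ℚ V
  form : LinearMap.BilinForm ℚ V
  form_comm (x y : V) : form x y = form y x
  form_pos (x : V) : x ≠ 0 → 0 < form x x
  form_smul (g : G) (x y : V) : form (g • x) (g • y) = form x y
  refl : S → G
  refl_smul (s : S) (x : V) :
    refl s • x = x - (2 * form x (basis s) / form (basis s) (basis s)) • basis s
  closure_refl : Subgroup.closure (Set.range refl) = ⊤
  eq_one_of_smul (g : G) : (∀ x : V, g • x = x) → g = 1
  pos : Set V
  basis_mem_pos (s : S) : basis s ∈ pos
  repr_nonneg_of_mem_pos (x : V) : x ∈ pos → ∀ s, 0 ≤ basis.repr x s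
  refl_smul_mem_pos (s : S) (x : V) : x ∈ pos → x ≠ basis s → refl s • x ∈ pos
  smul_basis_mem_pos_or (g : G) (s : S) : g • basis s ∈ pos ∨ -(g • basis s) ∈ pos

/-! ### Reflections, words and the exchange condition -/

namespace SimpleSystem

variable {G V S : Type*} [Group G] [AddCommGroup V] [Module ℚ V] [DistribMulAction G V]
  (D : SimpleSystem G V S)

/-- The subgroup generated by the simple reflections in `K`. -/
def parab (K : Set S) : Subgroup G := Subgroup.closure (D.refl '' K)

variable {D}

lemma basis_ne_zero (s : S) : D.basis s ≠ 0 := D.basis.ne_zero s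

lemma form_basis_pos (s : S) : 0 < D.form (D.basis s) (D.basis s) :=
  D.form_pos _ (basis_ne_zero s)

lemma eq_of_smul_eq (D : SimpleSystem G V S) {g h : G} (H : ∀ x : V, g • x = h • x) : g = h := by
  have := D.eq_one_of_smul (h⁻¹ * g) fun x => by rw [mul_smul, H, inv_smul_smul]
  rwa [inv_mul_eq_one, eq_comm] at this

lemma form_smul_left (g : G) (x y : V) : D.form (g • x) y = D.form x (g⁻¹ • y) := by
  rw [← D.form_smul g x, smul_inv_smul]

lemma refl_smul_basis (s : S) : D.refl s • D.basis s = - D.basis s := by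
  rw [D.refl_smul, mul_div_assoc, div_self (form_basis_pos s).ne', mul_one, two_smul]
  abel

lemma refl_smul_refl_smul (s : S) (x : V) : D.refl s • D.refl s • x = x := by
  have h : D.form (D.refl s • x) (D.basis s) = - D.form x (D.basis s) := by
    rw [← D.form_smul (D.refl s) x, refl_smul_basis, map_neg, neg_neg]
  rw [D.refl_smul s (D.refl s • x), h, D.refl_smul s x, mul_neg, neg_div, neg_smul]
  abel

lemma refl_mul_self (s : S) : D.refl s * D.refl s = 1 :=
  D.eq_one_of_smul _ fun x => by rw [mul_smul, refl_smul_refl_smul]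

lemma refl_inv (s : S) : (D.refl s)⁻¹ = D.refl s :=
  inv_eq_of_mul_eq_one_left (refl_mul_self s)

lemma refl_smul_eq_self_iff {s : S} {x : V} :
    D.refl s • x = x ↔ D.form x (D.basis s) = 0 := by
  rw [D.refl_smul, sub_eq_self, smul_eq_zero, or_iff_left (basis_ne_zero s)]
  simp [(form_basis_pos (D := D) s).ne']

lemma neg_notMem_pos {x : V} (hx : x ≠ 0) (h : x ∈ D.pos) : -x ∉ D.pos := fun h' => by
  apply hx
  rw [← D.basis.repr.map_eq_zero_iff]
  ext s
  have h1 := D.repr_nonneg_of_mem_pos _ h s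
  have h2 := D.repr_nonneg_of_mem_pos _ h' s
  simp only [map_neg, Finsupp.coe_neg, Pi.neg_apply] at h2
  simp only [Finsupp.coe_zero, Pi.zero_apply]
  linarith

lemma refl_mem_parab {K : Set S} {s : S} (hs : s ∈ K) : D.refl s ∈ D.parab K :=
  Subgroup.subset_closure ⟨s, hs, rfl⟩

lemma parab_mono {K L : Set S} (h : K ⊆ L) : D.parab K ≤ D.parab L :=
  Subgroup.closure_mono (Set.image_mono h)

lemma mem_parab_univ (g : G) : g ∈ D.parab Set.univ := by
  rw [parab, Set.image_univ, D.closure_refl]; trivial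

/-- Elements of a parabolic subgroup do not change the coordinates outside of it. -/
lemma repr_smul_of_mem_parab {K : Set S} {g : G} (hg : g ∈ D.parab K) {s : S} (hs : s ∉ K)
    (x : V) : D.basis.repr (g • x) s = D.basis.repr x s := by
  induction hg using Subgroup.closure_induction generalizing x with
  | mem g hg =>
    obtain ⟨t, ht, rfl⟩ := hg
    have : t ≠ s := fun h => hs (h ▸ ht)
    simp [D.refl_smul, this]
  | one => simp
  | mul g h _ _ h1 h2 => rw [mul_smul, h1, h2]
  | inv g _ h => rw [← h (g⁻¹ • x), smul_inv_smul]

variable (D) in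
/-- The product of the simple reflections in a word. -/
def word (l : List S) : G := (l.map D.refl).prod

@[simp] lemma word_nil : D.word [] = 1 := rfl

@[simp] lemma word_cons (s : S) (l : List S) : D.word (s :: l) = D.refl s * D.word l := by
  simp [word]

@[simp] lemma word_append (l m : List S) : D.word (l ++ m) = D.word l * D.word m := by
  simp [word]

lemma word_reverse (l : List S) : D.word l.reverse = (D.word l)⁻¹ := by
  induction l with
  | nil => simp
  | cons s l ih => simp [ih, refl_inv]

lemma word_mem_parab {K : Set S} {l : List S} (h : ∀ s ∈ l, s ∈ K) : D.word l ∈ D.parab K := by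
  induction l with
  | nil => exact one_mem _
  | cons s l ih =>
    rw [word_cons]
    exact mul_mem (refl_mem_parab (h s (by simp))) (ih fun t ht => h t (by simp [ht]))

lemma exists_word {K : Set S} {g : G} (hg : g ∈ D.parab K) :
    ∃ l : List S, (∀ s ∈ l, s ∈ K) ∧ D.word l = g := by
  induction hg using Subgroup.closure_induction with
  | mem g hg =>
    obtain ⟨t, ht, rfl⟩ := hg
    exact ⟨[t], by simpa using ht, by simp⟩
  | one => exact ⟨[], by simp, rfl⟩
  | mul g h _ _ h1 h2 =>
    obtain ⟨l, hl, rfl⟩ := h1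
    obtain ⟨m, hm, rfl⟩ := h2
    refine ⟨l ++ m, fun s hs => ?_, word_append l m⟩
    rcases List.mem_append.1 hs with h | h
    exacts [hl s h, hm s h]
  | inv g _ h =>
    obtain ⟨l, hl, rfl⟩ := h
    exact ⟨l.reverse, by simpa using hl, word_reverse l⟩

lemma conj_refl {g : G} {s t : S} (h : g • D.basis s = D.basis t) :
    g * D.refl s = D.refl t * g := by
  refine D.eq_of_smul_eq fun x => ?_
  rw [mul_smul, mul_smul, D.refl_smul, D.refl_smul, ← h, D.form_smul, D.form_smul, smul_sub]
  -- The action is only assumed additive; over ℚ this already makes it linear.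
  have key : ∀ (q : ℚ) (x : V), g • q • x = q • g • x := fun q x =>
    map_ratCast_smul (DistribSMul.toAddMonoidHom V g) ℚ ℚ q x
  rw [key]

/-- The exchange condition. -/
lemma exists_shorter_word (s : S) (l : List S) (h : -(D.word l • D.basis s) ∈ D.pos) :
    ∃ l' : List S, l' ⊆ l ∧ l'.length < l.length ∧ D.word l' = D.word l * D.refl s := by
  induction l with
  | nil =>
    simp only [word_nil, one_smul] at h
    exact absurd h (neg_notMem_pos (basis_ne_zero s) (D.basis_mem_pos s))
  | cons t m ih =>
    rcases D.smul_basis_mem_pos_or (D.word m) s with hm | hm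
    · have hne : D.word m • D.basis s ≠ 0 := by
        rw [Ne, smul_eq_zero_iff_eq]; exact basis_ne_zero s
      -- The reflection in t makes this positive vector negative, and the only member of `pos` that
      -- can leave `pos` under it is the simple root of t. Hence the two outer reflections cancel
      -- after conjugation.
      have heq : D.word m • D.basis s = D.basis t := by
        by_contra hne'
        refine neg_notMem_pos ?_ (D.refl_smul_mem_pos t _ hm hne') (by simpa [mul_smul] using h)
        rwa [Ne, smul_eq_zero_iff_eq]
      refine ⟨m, List.subset_cons_self _ _, by simp, ?_⟩
      rw [word_cons, mul_assoc, conj_refl heq, ← mul_assoc, refl_mul_self, one_mul]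
    · obtain ⟨l', h1, h2, h3⟩ := ih hm
      refine ⟨t :: l', List.cons_subset_cons _ h1, by simpa using h2, ?_⟩
      rw [word_cons, word_cons, h3, mul_assoc]

/-! ### Dominant vectors and their stabilizers -/

variable [Fintype S]

lemma form_eq_sum (v x : V) :
    D.form v x = ∑ s, D.basis.repr x s * D.form v (D.basis s) := by
  conv_lhs => rw [← D.basis.sum_repr x]
  simp only [map_sum, map_smul, smul_eq_mul]

/-- A vector dominant for `K` pairs nonnegatively with the cone spanned by the roots in `K`. -/
lemma form_nonneg {K : Set S} {v x : V} (hv : ∀ s ∈ K, 0 ≤ D.form v (D.basis s))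
    (hx : ∀ s, 0 ≤ D.basis.repr x s) (hx' : ∀ s ∉ K, D.basis.repr x s = 0) :
    0 ≤ D.form v x := by
  rw [form_eq_sum]
  refine Finset.sum_nonneg fun s _ => ?_
  by_cases hs : s ∈ K
  · exact mul_nonneg (hx s) (hv s hs)
  · simp [hx' s hs]

/-- Look at the last letter s of the word. If the rest of the word keeps the root of s positive,
dominance of both v and its image forces v to be orthogonal to that root, so s can be dropped.
Otherwise the exchange condition yields a shorter word in the same letters. Since the amount of
shortening is not controlled, the induction is on a bound for the length. -/
lemma word_fix_of_dominant {K : Set S} {v : V} (hv : ∀ s ∈ K, 0 ≤ D.form v (D.basis s)) (n : ℕ) :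
    ∀ l : List S, l.length ≤ n → (∀ s ∈ l, s ∈ K) →
      (∀ s ∈ K, 0 ≤ D.form (D.word l • v) (D.basis s)) →
      D.word l • v = v ∧ D.word l ∈ D.parab {s ∈ K | D.form v (D.basis s) = 0} := by
  induction n with
  | zero =>
    intro l hl _ _
    obtain rfl : l = [] := List.length_eq_zero_iff.1 (by omega)
    exact ⟨by simp, one_mem _⟩
  | succ n ih =>
    intro l hl hlK hd
    rcases List.eq_nil_or_concat l with rfl | ⟨m, s, rfl⟩
    · exact ⟨by simp, one_mem _⟩
    rw [List.concat_eq_append] at hl hlK hd ⊢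
    have hmK : ∀ t ∈ m, t ∈ K := fun t ht => hlK t (by simp [ht])
    have hsK : s ∈ K := hlK s (by simp)
    simp only [List.length_append, List.length_singleton] at hl
    have hw : D.word (m ++ [s]) = D.word m * D.refl s := by simp
    rcases D.smul_basis_mem_pos_or (D.word m) s with hp | hp
    · have h1 : D.form v (D.basis s) = - D.form (D.word (m ++ [s]) • v) (D.word m • D.basis s) := by
        rw [← D.form_smul (D.word (m ++ [s])) v, hw, mul_smul _ _ (D.basis s), refl_smul_basis,
          smul_neg, map_neg]
      have h2 : 0 ≤ D.form (D.word (m ++ [s]) • v) (D.word m • D.basis s) := by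
        refine form_nonneg hd (D.repr_nonneg_of_mem_pos _ hp) fun t ht => ?_
        rw [repr_smul_of_mem_parab (word_mem_parab hmK) ht]
        have : s ≠ t := fun h => ht (h ▸ hsK)
        simp [this]
      have h3 : D.form v (D.basis s) = 0 := le_antisymm (by linarith) (hv s hsK)
      have h4 : D.refl s • v = v := refl_smul_eq_self_iff.2 h3
      have h5 : D.word (m ++ [s]) • v = D.word m • v := by rw [hw, mul_smul, h4]
      rw [h5] at hd ⊢
      obtain ⟨h6, h7⟩ := ih m (by omega) hmK hd
      exact ⟨h6, hw ▸ mul_mem h7 (refl_mem_parab ⟨hsK, h3⟩)⟩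
    · obtain ⟨l', h1, h2, h3⟩ := exists_shorter_word s m hp
      rw [hw, ← h3] at hd ⊢
      exact ih l' (by omega) (fun t ht => hmK t (h1 ht)) hd

lemma fix_of_dominant {K : Set S} {v : V} (hv : ∀ s ∈ K, 0 ≤ D.form v (D.basis s)) {g : G}
    (hg : g ∈ D.parab K) (hgv : ∀ s ∈ K, 0 ≤ D.form (g • v) (D.basis s)) :
    g • v = v ∧ g ∈ D.parab {s ∈ K | D.form v (D.basis s) = 0} := by
  obtain ⟨l, hl, rfl⟩ := exists_word hg
  exact word_fix_of_dominant hv _ l le_rfl hl hgv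

/-- The stabilizer of a dominant vector is generated by the simple reflections in it. -/
lemma mem_parab_of_smul_eq {K : Set S} {v : V} (hv : ∀ s ∈ K, 0 ≤ D.form v (D.basis s)) {g : G}
    (hg : g ∈ D.parab K) (hgv : g • v = v) :
    g ∈ D.parab {s ∈ K | D.form v (D.basis s) = 0} :=
  (fix_of_dominant hv hg (by rwa [hgv])).2

/-- Among the translates of x that exceed x by a nonnegative combination of simple roots, take one
of maximal height (coordinate sum). Reflecting in a root of K that pairs negatively with it would
raise the height further. -/
lemma exists_smul_dominant [Finite G] (K : Set S) (x : V) :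
    ∃ g ∈ D.parab K, (∀ s ∈ K, 0 ≤ D.form (g • x) (D.basis s)) ∧
      ∀ s, 0 ≤ D.basis.repr (g • x - x) s := by
  obtain ⟨g, ⟨hgK, hg⟩, hmax⟩ := Set.exists_max_image
    {g : G | g ∈ D.parab K ∧ ∀ s, 0 ≤ D.basis.repr (g • x - x) s}
    (fun g => ∑ s, D.basis.repr (g • x) s) (Set.toFinite _) ⟨1, one_mem _, by simp⟩
  refine ⟨g, hgK, fun s hs => ?_, hg⟩
  by_contra! hneg
  set q := 2 * D.form (g • x) (D.basis s) / D.form (D.basis s) (D.basis s) with hq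
  have hq0 : q < 0 := div_neg_of_neg_of_pos (by linarith) (form_basis_pos s)
  have hsmul : (D.refl s * g) • x = g • x - q • D.basis s := by rw [mul_smul, D.refl_smul]
  classical
  have := hmax (D.refl s * g) ⟨mul_mem (refl_mem_parab hs) hgK, fun t => ?_⟩
  · rw [hsmul] at this
    simp [Finset.sum_sub_distrib, Finsupp.single_apply] at this
    linarith
  · have h := hg t
    rw [hsmul, sub_right_comm]
    by_cases hst : s = t
    · subst hst
      simp only [map_sub, map_smul, Module.Basis.repr_self, Finsupp.coe_sub, Finsupp.coe_smul,
        Pi.sub_apply, Pi.smul_apply, Finsupp.single_eq_same, smul_eq_mul, mul_one] at h ⊢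
      linarith
    · simpa [hst] using h

variable [Finite G]

/-- Moving g • v upwards to a dominant vector can only end at v, since an orbit contains a single
dominant vector. -/
lemma repr_sub_smul_nonneg {v : V} (hv : ∀ s, 0 ≤ D.form v (D.basis s)) (g : G) (s : S) :
    0 ≤ D.basis.repr (v - g • v) s := by
  obtain ⟨h, -, hd, hn⟩ := exists_smul_dominant (D := D) Set.univ (g • v)
  rw [← mul_smul] at hd hn
  rw [(fix_of_dominant (fun s _ => hv s) (mem_parab_univ (h * g)) hd).1] at hn
  exact hn s

/-- Make g • v dominant for K inside W_K; the result is v - b with b in the cone spanned by K.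
Equality of norms gives (b, b) = 2 (v, b), and dominance gives (v - b, b) ≥ 0. Together they force
(b, b) ≤ 0, so b = 0. -/
lemma exists_parab_smul_eq {v : V} (hv : ∀ s, 0 ≤ D.form v (D.basis s)) {K : Set S} {g : G}
    (hg : ∀ s ∉ K, D.basis.repr (v - g • v) s = 0) :
    ∃ u ∈ D.parab K, u • v = g • v := by
  obtain ⟨h, hK, hd, -⟩ := exists_smul_dominant (D := D) K (g • v)
  refine ⟨h⁻¹, inv_mem hK, ?_⟩
  rw [inv_smul_eq_iff]
  rw [← mul_smul] at hd ⊢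
  set b := v - (h * g) • v with hb
  have hb0 : ∀ s, 0 ≤ D.basis.repr b s := repr_sub_smul_nonneg hv _
  have hbK : ∀ s ∉ K, D.basis.repr b s = 0 := fun s hs => by
    rw [← hg s hs, hb, mul_smul, map_sub, map_sub, Finsupp.sub_apply, Finsupp.sub_apply,
      repr_smul_of_mem_parab hK hs]
  have h1 := form_nonneg (D := D) (K := K) (v := v) (fun s _ => hv s) hb0 hbK
  have h2 := form_nonneg hd hb0 hbK
  have h3 := D.form_smul (h * g) v v
  have hgv : (h * g) • v = v - b := by rw [hb]; abel
  by_contra hne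
  have h4 := D.form_pos b (sub_ne_zero.2 hne)
  rw [hgv] at h2 h3
  simp only [map_sub, LinearMap.sub_apply] at h2 h3
  rw [D.form_comm b v] at h3
  linarith

end SimpleSystem

/-! ### Convex hulls, spans and the group action -/

namespace SimpleSystem

section Convexity

variable {G V : Type*} [Group G] [AddCommGroup V] [Module ℚ V] [DistribMulAction G V]

lemma smul_convexHull (g : G) (A : Set V) : g • convexHull ℚ A = convexHull ℚ (g • A) :=
  (DistribSMul.toAddMonoidHom V g).toRatLinearMap.image_convexHull A

/-- The points of a convex hull that maximise a linear functional are the convex hull of the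
maximising generators. -/
lemma maximizers_convexHull {A : Set V} {f : Module.Dual ℚ V} {m : V} (hm : m ∈ A)
    (hf : ∀ a ∈ A, f a ≤ f m) :
    {x | x ∈ convexHull ℚ A ∧ ∀ y ∈ convexHull ℚ A, f y ≤ f x} =
      convexHull ℚ {a ∈ A | f a = f m} := by
  have hsub : convexHull ℚ A ⊆
      {x | f x ≤ f m ∧ (f x = f m → x ∈ convexHull ℚ {a ∈ A | f a = f m})} := by
    refine convexHull_min (fun a ha => ⟨hf a ha, fun h => subset_convexHull ℚ _ ⟨ha, h⟩⟩) ?_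
    rintro x ⟨hx, hx'⟩ y ⟨hy, hy'⟩ a b ha hb hab
    have hfm : f m = a * f m + b * f m := by rw [← add_mul, hab, one_mul]
    have h1 : a * f x ≤ a * f m := mul_le_mul_of_nonneg_left hx ha
    have h2 : b * f y ≤ b * f m := mul_le_mul_of_nonneg_left hy hb
    simp only [Set.mem_ofPred_eq, map_add, map_smul, smul_eq_mul]
    refine ⟨by linarith, fun h => ?_⟩
    rcases ha.eq_or_lt with rfl | ha
    · obtain rfl : b = 1 := by linarith
      simpa using hy' (by linarith)
    rcases hb.eq_or_lt with rfl | hb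
    · obtain rfl : a = 1 := by linarith
      simpa using hx' (by linarith)
    · refine convex_convexHull ℚ _ (hx' ?_) (hy' ?_) ha.le hb.le hab
      · exact mul_left_cancel₀ ha.ne' (by linarith)
      · exact mul_left_cancel₀ hb.ne' (by linarith)
  apply Set.Subset.antisymm
  · rintro x ⟨hx, hx'⟩
    exact (hsub hx).2 (le_antisymm (hsub hx).1 (hx' m (subset_convexHull ℚ _ hm)))
  · intro x hx
    have hfx : f x = f m := by
      have : convexHull ℚ {a ∈ A | f a = f m} ⊆ {x | f x = f m} :=
        convexHull_min (fun a ha => ha.2) (convex_hyperplane f.isLinear _)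
      exact this hx
    exact ⟨convexHull_mono (Set.sep_subset _ _) hx, fun y hy => hfx ▸ (hsub hy).1⟩

lemma smul_mem_vectorSpan {A : Set V} {g : G} (hg : g • A = A) {x : V} (hx : x ∈ vectorSpan ℚ A) :
    g • x ∈ vectorSpan ℚ A := by
  have : vectorSpan ℚ A ≤
      (vectorSpan ℚ A).comap (DistribSMul.toAddMonoidHom V g).toRatLinearMap := by
    conv_lhs => rw [vectorSpan_def]
    rw [Submodule.span_le]
    rintro _ ⟨a, ha, b, hb, rfl⟩
    change g • (a - b) ∈ vectorSpan ℚ A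
    rw [smul_sub]
    exact vsub_mem_vectorSpan ℚ (hg ▸ Set.smul_mem_smul_set ha) (hg ▸ Set.smul_mem_smul_set hb)
  exact this hx

lemma vectorSpan_smul (g : G) (A : Set V) :
    vectorSpan ℚ (g • A) =
      (vectorSpan ℚ A).map (DistribSMul.toAddMonoidHom V g).toRatLinearMap := by
  rw [vectorSpan_def, vectorSpan_def, Submodule.map_span]
  congr 1
  ext x
  constructor
  · rintro ⟨_, ⟨a, ha, rfl⟩, _, ⟨b, hb, rfl⟩, rfl⟩
    exact ⟨a - b, ⟨a, ha, b, hb, rfl⟩, smul_sub g a b⟩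
  · rintro ⟨_, ⟨a, ha, b, hb, rfl⟩, rfl⟩
    exact ⟨g • a, ⟨a, ha, rfl⟩, g • b, ⟨b, hb, rfl⟩, (smul_sub g a b).symm⟩

lemma dim_smul (g : G) (A : Set V) : dim (g • A) = dim A := by
  rw [dim, dim, vectorSpan_smul]
  exact (Submodule.equivMapOfInjective _ (MulAction.injective g) _).finrank_eq.symm

lemma vectorSpan_convexHull (A : Set V) : vectorSpan ℚ (convexHull ℚ A) = vectorSpan ℚ A := by
  rw [← direction_affineSpan, affineSpan_convexHull, direction_affineSpan]

end Convexity

/-! ### Cells and admissible sets of simple roots -/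

variable {G V S : Type*} [Group G] [AddCommGroup V] [Module ℚ V] [DistribMulAction G V]
  (D : SimpleSystem G V S)

/-- The convex hull of the orbit of `v` under a standard parabolic subgroup. -/
def cell (v : V) (K : Set S) : Set V := convexHull ℚ ((fun g : G => g • v) '' D.parab K)

/-- No nonempty part of `I` that is orthogonal to the rest of `I` consists of roots
orthogonal to `v`. -/
def IsAdm (v : V) (I : Set S) : Prop :=
  ∀ A ⊆ I, (∀ s ∈ A, D.form v (D.basis s) = 0) →
    (∀ s ∈ A, ∀ t ∈ I \ A, D.form (D.basis s) (D.basis t) = 0) → A = ∅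

/-- `I` together with the simple roots orthogonal to `v` and to all of `I`. -/
def closureSet (v : V) (I : Set S) : Set S :=
  I ∪ {s | D.form v (D.basis s) = 0 ∧ ∀ t ∈ I, D.form (D.basis s) (D.basis t) = 0}

variable {D}

lemma smul_eq_self_of_mem_parab {K : Set S} {x : V} (hx : ∀ s ∈ K, D.form x (D.basis s) = 0)
    {g : G} (hg : g ∈ D.parab K) : g • x = x := by
  have : D.parab K ≤ MulAction.stabilizer G x := by
    rw [parab, Subgroup.closure_le]
    rintro _ ⟨s, hs, rfl⟩
    exact refl_smul_eq_self_iff.2 (hx s hs)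
  exact this hg

/-- The additional generators fix the whole W_I-orbit of v, because their roots are orthogonal to v
and to I. -/
lemma exists_mem_parab_of_mem_parab_closureSet {v : V} {I : Set S} {g : G}
    (hg : g ∈ D.parab (D.closureSet v I)) : ∃ u ∈ D.parab I, g • v = u • v := by
  obtain ⟨l, hl, rfl⟩ := exists_word hg
  clear hg
  induction l with
  | nil => exact ⟨1, one_mem _, rfl⟩
  | cons s m ih =>
    obtain ⟨u, hu, hm⟩ := ih fun t ht => hl t (by simp [ht])
    rw [word_cons, mul_smul, hm]
    rcases hl s (by simp) with hs | ⟨hsv, hsI⟩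
    · exact ⟨D.refl s * u, mul_mem (refl_mem_parab hs) hu, (mul_smul _ _ _).symm⟩
    · refine ⟨u, hu, refl_smul_eq_self_iff.2 ?_⟩
      rw [form_smul_left, smul_eq_self_of_mem_parab hsI (inv_mem hu), hsv]

lemma cell_eq_of_subset {v : V} {I K : Set S} (hIK : I ⊆ K) (hK : K ⊆ D.closureSet v I) :
    D.cell v K = D.cell v I := by
  unfold cell
  congr 1
  apply Set.Subset.antisymm
  · rintro _ ⟨g, hg, rfl⟩
    obtain ⟨u, hu, h⟩ := exists_mem_parab_of_mem_parab_closureSet (parab_mono hK hg)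
    exact ⟨u, hu, h.symm⟩
  · exact Set.image_mono (parab_mono hIK)

lemma smul_orbit_eq {v : V} {K : Set S} {g : G} (hg : g ∈ D.parab K) :
    g • ((fun g : G => g • v) '' D.parab K) = (fun g : G => g • v) '' D.parab K := by
  ext x
  rw [Set.mem_smul_set_iff_inv_smul_mem]
  constructor
  · rintro ⟨u, hu, h⟩
    exact ⟨g * u, mul_mem hg hu, by simp only at h ⊢; rw [mul_smul, h, smul_inv_smul]⟩
  · rintro ⟨u, hu, rfl⟩
    exact ⟨g⁻¹ * u, mul_mem (inv_mem hg) hu, mul_smul _ _ _⟩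

lemma smul_cell_of_mem {v : V} {K : Set S} {g : G} (hg : g ∈ D.parab K) :
    g • D.cell v K = D.cell v K := by
  rw [cell, smul_convexHull, smul_orbit_eq hg]

lemma smul_cell_of_mem_closureSet {v : V} {I : Set S} {g : G}
    (hg : g ∈ D.parab (D.closureSet v I)) : g • D.cell v I = D.cell v I := by
  rw [← cell_eq_of_subset Set.subset_union_left subset_rfl]
  exact smul_cell_of_mem hg

lemma mem_cell_self (v : V) (K : Set S) : v ∈ D.cell v K :=
  subset_convexHull ℚ _ ⟨1, one_mem _, one_smul G v⟩

/-- The subsets of K orthogonal to v and to the rest of K are closed under union; I is the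
complement in K of the largest one. -/
lemma exists_isAdm (v : V) (K : Set S) :
    ∃ I ⊆ K, D.IsAdm v I ∧ K ⊆ D.closureSet v I := by
  set good : Set S → Prop := fun A => A ⊆ K ∧ (∀ s ∈ A, D.form v (D.basis s) = 0) ∧
    ∀ s ∈ A, ∀ t ∈ K \ A, D.form (D.basis s) (D.basis t) = 0 with hgood
  set A : Set S := ⋃₀ {B | good B} with hA
  have hAgood : good A := by
    refine ⟨Set.sUnion_subset fun B hB => hB.1, ?_, ?_⟩
    · rintro s ⟨B, hB, hs⟩
      exact hB.2.1 s hs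
    · rintro s ⟨B, hB, hs⟩ t ⟨htK, ht⟩
      exact hB.2.2 s hs t ⟨htK, fun h => ht ⟨B, hB, h⟩⟩
  refine ⟨K \ A, Set.sdiff_subset, fun B hB hv hB' => ?_, fun s hs => ?_⟩
  · have : good (A ∪ B) := by
      refine ⟨Set.union_subset hAgood.1 (hB.trans Set.sdiff_subset), ?_, ?_⟩
      · rintro s (hs | hs)
        exacts [hAgood.2.1 s hs, hv s hs]
      · rintro s (hs | hs) t ⟨ht, ht'⟩
        · exact hAgood.2.2 s hs t ⟨ht, fun h => ht' (Or.inl h)⟩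
        · exact hB' s hs t ⟨⟨ht, fun h => ht' (Or.inl h)⟩, fun h => ht' (Or.inr h)⟩
    refine Set.eq_empty_of_forall_notMem fun s hs => (hB hs).2 ?_
    exact ⟨A ∪ B, this, Or.inr hs⟩
  · by_cases h : s ∈ A
    · exact Or.inr ⟨hAgood.2.1 s h, fun t ht => hAgood.2.2 s h t ht⟩
    · exact Or.inl ⟨hs, h⟩

lemma repr_eq_of_mem_cell {v : V} {K : Set S} {x : V} (hx : x ∈ D.cell v K) {s : S} (hs : s ∉ K) :
    D.basis.repr x s = D.basis.repr v s := by
  have : D.cell v K ⊆ {x | D.basis.coord s x = D.basis.repr v s} := by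
    refine convexHull_min ?_ (convex_hyperplane (D.basis.coord s).isLinear _)
    rintro _ ⟨g, hg, rfl⟩
    exact repr_smul_of_mem_parab hg hs v
  exact this hx

lemma basis_mem_span {K : Set S} {x : V} :
    x ∈ Submodule.span ℚ (D.basis '' K) ↔ ∀ s ∉ K, D.basis.repr x s = 0 := by
  rw [Module.Basis.mem_span_image]
  constructor
  · intro h s hs
    by_contra hne
    exact hs (h (Finsupp.mem_support_iff.2 hne))
  · intro h s hs
    by_contra hne
    exact Finsupp.mem_support_iff.1 hs (h s hne)

lemma vectorSpan_cell_le (v : V) (K : Set S) :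
    vectorSpan ℚ (D.cell v K) ≤ Submodule.span ℚ (D.basis '' K) := by
  rw [vectorSpan_def, Submodule.span_le]
  rintro _ ⟨a, ha, b, hb, rfl⟩
  refine basis_mem_span.2 fun s hs => ?_
  simp [repr_eq_of_mem_cell ha hs, repr_eq_of_mem_cell hb hs]

lemma basis_mem_of_refl_sub_mem {W : Submodule ℚ V} {x : V} {s : S}
    (h : D.form x (D.basis s) ≠ 0) (hx : x - D.refl s • x ∈ W) : D.basis s ∈ W := by
  rw [D.refl_smul, sub_sub_cancel] at hx
  refine (W.smul_mem_iff (div_ne_zero (mul_ne_zero two_ne_zero h) ?_)).1 hx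
  exact (form_basis_pos s).ne'

/-- The simple roots of I missing from the span W form a set of the kind that admissibility declares
empty. If s is not orthogonal to v, the difference of v and its reflection puts the root of s into
W; if s is not orthogonal to a root already in W, stability of W under W_I does the same. -/
lemma vectorSpan_cell {v : V} {I : Set S} (hI : D.IsAdm v I) :
    vectorSpan ℚ (D.cell v I) = Submodule.span ℚ (D.basis '' I) := by
  refine le_antisymm (vectorSpan_cell_le v I) ?_
  rw [cell, vectorSpan_convexHull]
  set W := vectorSpan ℚ ((fun g : G => g • v) '' D.parab I) with hW
  have hA : {s ∈ I | D.basis s ∉ W} = ∅ := by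
    refine hI _ (Set.sep_subset _ _) ?_ ?_
    · rintro s ⟨hsI, hs⟩
      by_contra hne
      exact hs (basis_mem_of_refl_sub_mem hne (vsub_mem_vectorSpan ℚ ⟨1, one_mem _, one_smul G v⟩
        ⟨D.refl s, refl_mem_parab hsI, rfl⟩))
    · rintro s ⟨hsI, hs⟩ t ⟨htI, ht⟩
      have htW : D.basis t ∈ W := by
        by_contra h
        exact ht ⟨htI, h⟩
      by_contra hne
      rw [D.form_comm] at hne
      exact hs (basis_mem_of_refl_sub_mem hne (sub_mem htW
        (smul_mem_vectorSpan (smul_orbit_eq (refl_mem_parab hsI)) htW)))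
  rw [Submodule.span_le]
  rintro _ ⟨s, hs, rfl⟩
  by_contra h
  exact (hA ▸ (⟨hs, h⟩ : s ∈ {s ∈ I | D.basis s ∉ W}) : s ∈ (∅ : Set S))

lemma dim_cell {v : V} {I : Finset S} (hI : D.IsAdm v I) : dim (D.cell v I) = I.card := by
  rw [dim, vectorSpan_cell hI]
  have h := finrank_span_eq_card (R := ℚ) (b := fun i : I => D.basis i)
    (D.basis.linearIndependent.comp _ Subtype.val_injective)
  rw [Fintype.card_coe] at h
  rw [← h, Set.image_eq_range]
  rfl

/-- Reflecting the root of s in t gives a positive vector, whose coordinate at t is a negative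
multiple of this pairing. -/
lemma form_basis_nonpos {s t : S} (h : s ≠ t) : D.form (D.basis s) (D.basis t) ≤ 0 := by
  have hne : D.basis s ≠ D.basis t := fun h' => h (D.basis.injective h')
  have := D.repr_nonneg_of_mem_pos _ (D.refl_smul_mem_pos t _ (D.basis_mem_pos s) hne) t
  rw [D.refl_smul] at this
  simp only [map_sub, map_smul, Module.Basis.repr_self, Finsupp.coe_sub, Finsupp.coe_smul,
    Pi.sub_apply, Pi.smul_apply, Finsupp.single_eq_same, smul_eq_mul, mul_one,
    Finsupp.single_eq_of_ne' h] at this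
  have h2 : 2 * D.form (D.basis s) (D.basis t) / D.form (D.basis t) (D.basis t) ≤ 0 := by
    linarith
  by_contra! hpos
  have := div_pos (mul_pos two_pos hpos) (form_basis_pos (D := D) t)
  linarith

end SimpleSystem

/-! ### Faces of the orbit polytope as translates of cells -/

namespace SimpleSystem

variable {G V S : Type*} [Group G] [AddCommGroup V] [Module ℚ V] [DistribMulAction G V]
  {D : SimpleSystem G V S} [Fintype S]

lemma exists_form_eq (f : Module.Dual ℚ V) : ∃ x : V, ∀ y, f y = D.form x y := by
  have : Module.Finite ℚ V := Module.Finite.of_basis D.basis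
  have hinj : Function.Injective D.form := by
    rw [injective_iff_map_eq_zero]
    intro x hx
    by_contra hne
    simpa [hx] using D.form_pos x hne
  obtain ⟨x, rfl⟩ := (LinearMap.injective_iff_surjective_of_finrank_eq_finrank
    (Subspace.dual_finrank_eq (K := ℚ) (V := V)).symm).1 hinj f
  exact ⟨x, fun _ => rfl⟩

variable (D) in
lemma exists_form_basis_eq (q : S → ℚ) : ∃ x : V, ∀ s, D.form x (D.basis s) = q s := by
  obtain ⟨x, hx⟩ := exists_form_eq (D := D) (D.basis.constr ℚ q)
  exact ⟨x, fun s => by rw [← hx, Module.Basis.constr_basis]⟩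

variable [Finite G]

lemma form_smul_eq_iff {x v : V} (hx : ∀ s, 0 ≤ D.form x (D.basis s))
    (hv : ∀ s, 0 ≤ D.form v (D.basis s)) (g : G) :
    D.form x (g • v) = D.form x v ↔
      ∀ s ∉ {s | D.form x (D.basis s) = 0}, D.basis.repr (v - g • v) s = 0 := by
  rw [eq_comm, ← sub_eq_zero, ← map_sub, form_eq_sum, Finset.sum_eq_zero_iff_of_nonneg
    fun s _ => mul_nonneg (repr_sub_smul_nonneg hv g s) (hx s)]
  simp only [Finset.mem_univ, true_imp_iff, mul_eq_zero, Set.mem_ofPred_eq]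
  exact forall_congr' fun s => by tauto

/-- The face of the orbit polytope in the direction of a dominant vector, up to the action
of the group. -/
lemma maximizers_eq_smul_cell {x v : V} (hx : ∀ s, 0 ≤ D.form x (D.basis s))
    (hv : ∀ s, 0 ≤ D.form v (D.basis s)) (g : G) :
    {y | y ∈ convexHull ℚ (Set.range fun h : G => h • v) ∧
      ∀ z ∈ convexHull ℚ (Set.range fun h : G => h • v), D.form (g • x) z ≤ D.form (g • x) y} =
    g • D.cell v {s | D.form x (D.basis s) = 0} := by
  have hle : ∀ h : G, D.form x (h • v) ≤ D.form x v := fun h => by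
    have := form_nonneg (D := D) (K := Set.univ) (fun s _ => hx s)
      (repr_sub_smul_nonneg hv h) (by simp)
    rw [map_sub] at this
    linarith
  rw [maximizers_convexHull (m := g • v) (Set.mem_range_self g) ?_, cell, smul_convexHull]
  · congr 1
    ext y
    rw [Set.mem_smul_set_iff_inv_smul_mem]
    constructor
    · rintro ⟨⟨h, rfl⟩, hy⟩
      simp only [D.form_smul] at hy
      rw [form_smul_left, ← mul_smul, form_smul_eq_iff hx hv] at hy
      obtain ⟨u, hu, h⟩ := exists_parab_smul_eq hv hy
      exact ⟨u, hu, by simp only [h, mul_smul]⟩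
    · rintro ⟨u, hu, h⟩
      obtain rfl : y = (g * u) • v := by
        rw [mul_smul, ← inv_smul_eq_iff]; exact h.symm
      refine ⟨⟨_, rfl⟩, ?_⟩
      rw [mul_smul, D.form_smul, D.form_smul, form_smul_eq_iff hx hv]
      intro s hs
      rw [map_sub, Finsupp.sub_apply, repr_smul_of_mem_parab hu hs, sub_self]
  · rintro _ ⟨h, rfl⟩
    simp only [D.form_smul]
    rw [form_smul_left, ← mul_smul]
    exact hle _

lemma isFace_iff {v : V} (hv : ∀ s, 0 ≤ D.form v (D.basis s)) {F : Set V} :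
    IsFace (convexHull ℚ (Set.range fun h : G => h • v)) F ↔
      ∃ (g : G) (K : Set S), F = g • D.cell v K := by
  constructor
  · rintro ⟨-, f, rfl⟩
    obtain ⟨x, hx⟩ := exists_form_eq (D := D) f
    obtain ⟨g, -, hg, -⟩ := exists_smul_dominant (D := D) Set.univ x
    refine ⟨g⁻¹, {s | D.form (g • x) (D.basis s) = 0}, ?_⟩
    rw [← maximizers_eq_smul_cell (fun s => hg s trivial) hv g⁻¹, inv_smul_smul]
    simp only [hx]
  · rintro ⟨g, K, rfl⟩
    classical
    -- A dominant vector orthogonal to exactly the simple roots in K; it exposes the given cell.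
    obtain ⟨x, hx⟩ := D.exists_form_basis_eq fun s => if s ∈ K then 0 else 1
    refine ⟨⟨g • v, Set.smul_mem_smul_set (mem_cell_self v K)⟩, D.form (g • x), ?_⟩
    have hK : {s | D.form x (D.basis s) = 0} = K := by
      ext s
      simp [hx]
    rw [maximizers_eq_smul_cell (fun s => ?_) hv g, hK]
    rw [hx]
    split_ifs <;> simp

lemma isFace_iff_isAdm {v : V} (hv : ∀ s, 0 ≤ D.form v (D.basis s)) {F : Set V} :
    IsFace (convexHull ℚ (Set.range fun h : G => h • v)) F ↔
      ∃ (I : Finset S), D.IsAdm v I ∧ F ∈ MulAction.orbit G (D.cell v (I : Set S)) := by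
  classical
  rw [isFace_iff hv]
  constructor
  · rintro ⟨g, K, rfl⟩
    obtain ⟨I, hIK, hI, hK⟩ := exists_isAdm (D := D) v K
    refine ⟨I.toFinset, by simpa using hI, g, ?_⟩
    simp [cell_eq_of_subset hIK hK]
  · rintro ⟨I, -, g, rfl⟩
    exact ⟨g, I, rfl⟩

/-! ### Stabilizers and orbits of cells -/

omit [Finite G] in
/-- If `w` lies in the stabilizer of `v` and fixes the simple roots in `I` not in `K`, where `K`
is minimal with `w` in the parabolic subgroup of `K`, then `K` is orthogonal to `I`. -/
lemma orthogonal_of_isAdm {v : V} {I K : Set S} (hI : D.IsAdm v I) {w : G}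
    (hw : w ∈ D.parab K) (hKv : ∀ s ∈ K, D.form v (D.basis s) = 0)
    (hmin : ∀ L ⊆ K, w ∈ D.parab L → L = K)
    (hfix : ∀ s ∈ I \ K, w • D.basis s = D.basis s) :
    ∀ s ∈ I, s ∉ K ∧ ∀ t ∈ K, D.form (D.basis s) (D.basis t) = 0 := by
  have horth : ∀ s ∈ I \ K, ∀ t ∈ K, D.form (D.basis s) (D.basis t) = 0 := by
    intro s hs t ht
    -- For s outside K the negative of its root is dominant for K and fixed by w. So w lies in the
    -- parabolic subgroup of those roots in K orthogonal to it, and by minimality these are all of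
    -- K.
    have hdom : ∀ t ∈ K, 0 ≤ D.form (-D.basis s) (D.basis t) := fun t ht => by
      have := form_basis_nonpos (D := D) (s := s) (t := t) fun h => hs.2 (h ▸ ht)
      simpa using this
    have := hmin _ (Set.sep_subset _ _) (mem_parab_of_smul_eq hdom hw (by
      rw [smul_neg, hfix s hs]))
    rw [← this] at ht
    simpa using ht.2
  have hIK : I ∩ K = ∅ := by
    refine hI _ Set.inter_subset_left (fun s hs => hKv s hs.2) fun s hs t ht => ?_
    rw [D.form_comm]
    exact horth t ⟨ht.1, fun h => ht.2 ⟨ht.1, h⟩⟩ s hs.2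
  intro s hs
  have : s ∉ K := fun h => (hIK ▸ (⟨hs, h⟩ : s ∈ I ∩ K) : s ∈ (∅ : Set S))
  exact ⟨this, horth s ⟨hs, this⟩⟩

omit [Finite G] in
lemma form_pos_of_mem_pos {x y : V} (hx : ∀ s, D.form x (D.basis s) = 1) (hy : y ∈ D.pos)
    (hy0 : y ≠ 0) : 0 < D.form x y := by
  have h0 := D.repr_nonneg_of_mem_pos y hy
  rw [form_eq_sum]
  refine Finset.sum_pos' (fun s _ => by rw [hx, mul_one]; exact h0 s) ?_
  by_contra! h
  apply hy0
  rw [← D.basis.repr.map_eq_zero_iff]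
  ext s
  have := h s (Finset.mem_univ s)
  rw [hx, mul_one] at this
  exact le_antisymm this (h0 s)

omit [Finite G] in
lemma mem_pos_of_form_nonneg {x : V} (hx : ∀ s, D.form x (D.basis s) = 1) {g : G} {s : S}
    (h : 0 ≤ D.form x (g • D.basis s)) : g • D.basis s ∈ D.pos := by
  refine (D.smul_basis_mem_pos_or g s).resolve_right fun hneg => ?_
  have := form_pos_of_mem_pos hx hneg (by
    rw [Ne, neg_eq_zero, smul_eq_zero_iff_eq]; exact basis_ne_zero s)
  rw [map_neg] at this
  linarith

omit [Finite G] in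
lemma smul_eq_sum (g : G) (x : V) : g • x = ∑ s, D.basis.repr x s • g • D.basis s := by
  have := map_sum (DistribSMul.toAddMonoidHom V g).toRatLinearMap
    (fun s => D.basis.repr x s • D.basis s) Finset.univ
  rw [D.basis.sum_repr] at this
  simp only [map_smul] at this
  exact this

omit [Finite G] in
lemma repr_smul_eq_sum (g : G) (x : V) (t : S) :
    D.basis.repr (g • x) t = ∑ s, D.basis.repr x s * D.basis.repr (g • D.basis s) t := by
  rw [smul_eq_sum (D := D) g x]
  simp

omit [Finite G] in
/-- An element that maps the positive roots of `I` to positive roots spanned by `I'`, with inverse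
mapping the span of `I'` to that of `I`, fixes the simple roots that occur in their own image. -/
lemma smul_basis_eq_of_repr {I I' K : Set S} {w : G} (hw : w ∈ D.parab K)
    (hpos : ∀ s ∈ I, w • D.basis s ∈ D.pos)
    (hI' : ∀ s ∈ I, ∀ t ∉ I', D.basis.repr (w • D.basis s) t = 0)
    (hI : ∀ t ∈ I', ∀ s ∉ I, D.basis.repr (w⁻¹ • D.basis t) s = 0) {s : S} (hs : s ∈ I \ K) :
    w • D.basis s = D.basis s := by
  have hposinv : ∀ t ∈ I', w⁻¹ • D.basis t ∈ D.pos := by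
    intro t ht
    refine (D.smul_basis_mem_pos_or w⁻¹ t).resolve_right fun hneg => ?_
    have h1 := repr_smul_eq_sum (D := D) w (-(w⁻¹ • D.basis t)) t
    rw [smul_neg, smul_inv_smul] at h1
    have h2 : 0 ≤ D.basis.repr (-D.basis t) t := by
      rw [h1]
      refine Finset.sum_nonneg fun u _ => ?_
      by_cases hu : u ∈ I
      · exact mul_nonneg (D.repr_nonneg_of_mem_pos _ hneg u)
          (D.repr_nonneg_of_mem_pos _ (hpos u hu) t)
      · simp [hI t ht u hu]
    simp at h2
    linarith
  have hws : D.basis.repr (w • D.basis s) s = 1 := by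
    rw [repr_smul_of_mem_parab hw hs.2]; simp
  have hsI' : s ∈ I' := by
    by_contra h
    rw [hI' s hs.1 s h] at hws
    exact zero_ne_one hws
  suffices h : w⁻¹ • D.basis s = D.basis s by rw [eq_comm, ← inv_smul_eq_iff, h]
  apply D.basis.repr.injective
  ext u
  by_cases hu : u = s
  · subst hu
    rw [repr_smul_of_mem_parab (inv_mem hw) hs.2]
  · rw [Module.Basis.repr_self, Finsupp.single_eq_of_ne hu]
    -- The coordinate at u ≠ s of the root of s, expanded through w and its inverse, is a vanishing
    -- sum of nonnegative terms. The term at s has coefficient 1, so it gives the desired coordinate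
    -- of the inverse image.
    have h1 := repr_smul_eq_sum (D := D) w⁻¹ (w • D.basis s) u
    rw [inv_smul_smul, Module.Basis.repr_self, Finsupp.single_eq_of_ne hu, eq_comm,
      Finset.sum_eq_zero_iff_of_nonneg] at h1
    · have := h1 s (Finset.mem_univ s)
      rwa [hws, one_mul] at this
    · intro t _
      by_cases ht : t ∈ I'
      · exact mul_nonneg (D.repr_nonneg_of_mem_pos _ (hpos s hs.1) t)
          (D.repr_nonneg_of_mem_pos _ (hposinv t ht) u)
      · simp [hI' s hs.1 t ht]

omit [Finite G] [Fintype S] in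
lemma smul_mem_span_of_smul_cell_eq {v : V} {I I' : Set S} (hI : D.IsAdm v I)
    {g : G} (h : g • D.cell v I = D.cell v I') {s : S} (hs : s ∈ I) {t : S} (ht : t ∉ I') :
    D.basis.repr (g • D.basis s) t = 0 := by
  refine basis_mem_span.1 (vectorSpan_cell_le (D := D) v I' ?_) t ht
  rw [← h, vectorSpan_smul, vectorSpan_cell hI]
  exact ⟨D.basis s, Submodule.subset_span ⟨s, hs, rfl⟩, rfl⟩

/-- Correct g by an element of W_I so that it fixes v, and then by an element of the parabolic
subgroup of I ∩ J so that the resulting w keeps the simple roots of I positive. Neither correction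
moves the cell of I. Now w lies in W_J; for a minimal K ⊆ J with w in W_K, w fixes the roots of I
outside K, so admissibility makes K disjoint from I and orthogonal to it. Thus K lies in
`closureSet`, and w fixes every root of I, which gives I ⊆ I'. -/
lemma mem_parab_closureSet_of_smul_cell_eq {v : V} (hv : ∀ s, 0 ≤ D.form v (D.basis s))
    {I I' : Set S} (hI : D.IsAdm v I) (hI' : D.IsAdm v I') {g : G}
    (hg : g • D.cell v I = D.cell v I') : g ∈ D.parab (D.closureSet v I) ∧ I ⊆ I' := by
  obtain ⟨u, hu, huv⟩ : ∃ u ∈ D.parab I, u • v = g⁻¹ • v := by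
    refine exists_parab_smul_eq hv fun s hs => ?_
    have : g⁻¹ • v ∈ D.cell v I := by
      rw [← Set.mem_smul_set_iff_inv_smul_mem, hg]
      exact mem_cell_self v I'
    rw [map_sub, Finsupp.sub_apply, repr_eq_of_mem_cell this hs, sub_self]
  set w₀ := g * u with hw₀
  have hw₀v : w₀ • v = v := by rw [hw₀, mul_smul, huv, smul_inv_smul]
  -- The vector ρ detects signs: the image of a simple root is positive as soon as it pairs
  -- nonnegatively with ρ.
  obtain ⟨ρ, hρ⟩ := D.exists_form_basis_eq fun _ => 1
  set J : Set S := {s | D.form v (D.basis s) = 0} with hJ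
  obtain ⟨h, hh, hdom, -⟩ := exists_smul_dominant (D := D) (I ∩ J) (w₀⁻¹ • ρ)
  have hhv : h⁻¹ • v = v :=
    smul_eq_self_of_mem_parab (fun s hs => hs.2) (inv_mem hh)
  have hhI : h⁻¹ ∈ D.parab I := parab_mono Set.inter_subset_left (inv_mem hh)
  set w := w₀ * h⁻¹ with hw
  have hwv : w • v = v := by rw [hw, mul_smul, hhv, hw₀v]
  have hwJ : w ∈ D.parab J := by
    have := mem_parab_of_smul_eq (fun s _ => hv s) (mem_parab_univ w) hwv
    simpa using this
  have hwcell : w • D.cell v I = D.cell v I' := by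
    rw [hw, hw₀, mul_smul, mul_smul, smul_cell_of_mem hhI, smul_cell_of_mem hu, hg]
  have hwcell' : w⁻¹ • D.cell v I' = D.cell v I := by rw [← hwcell, inv_smul_smul]
  have hpos : ∀ s ∈ I, w • D.basis s ∈ D.pos := by
    intro s hs
    by_cases hsJ : s ∈ J
    · refine mem_pos_of_form_nonneg hρ ?_
      have := hdom s ⟨hs, hsJ⟩
      rwa [form_smul_left, form_smul_left, inv_inv, ← mul_smul] at this
    -- For s outside J, w does not change the coordinate at s, which is 1, so the image cannot be
    -- negative.
    · refine (D.smul_basis_mem_pos_or w s).resolve_right fun hneg => ?_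
      have := D.repr_nonneg_of_mem_pos _ hneg s
      rw [map_neg, Finsupp.neg_apply, repr_smul_of_mem_parab hwJ hsJ] at this
      simp at this
      linarith
  have hII' : ∀ s ∈ I, ∀ t ∉ I', D.basis.repr (w • D.basis s) t = 0 :=
    fun s hs t ht => smul_mem_span_of_smul_cell_eq hI hwcell hs ht
  obtain ⟨K, ⟨hKJ, hwK⟩, hmin⟩ := (Set.toFinite {K : Set S | K ⊆ J ∧ w ∈ D.parab K}).exists_minimal
    ⟨J, subset_rfl, hwJ⟩
  have hfix : ∀ s ∈ I \ K, w • D.basis s = D.basis s := fun s hs =>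
    smul_basis_eq_of_repr hwK hpos hII'
      (fun s hs t ht => smul_mem_span_of_smul_cell_eq hI' hwcell' hs ht) hs
  have horth := orthogonal_of_isAdm hI hwK (fun s hs => hKJ hs)
    (fun L hL hwL => hL.antisymm (hmin ⟨hL.trans hKJ, hwL⟩ hL)) hfix
  constructor
  · have h1 : w ∈ D.parab (D.closureSet v I) := by
      refine parab_mono (fun s hs => Or.inr ⟨hKJ hs, fun t ht => ?_⟩) hwK
      rw [D.form_comm]
      exact (horth t ht).2 s hs
    have h2 : g = w * h * u⁻¹ := by rw [hw, hw₀]; group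
    have hmono : D.parab I ≤ D.parab (D.closureSet v I) := parab_mono Set.subset_union_left
    rw [h2]
    exact mul_mem (mul_mem h1 (hmono (inv_mem_iff.1 hhI))) (hmono (inv_mem hu))
  · intro s hs
    by_contra hs'
    have := hII' s hs s hs'
    rw [hfix s ⟨hs, (horth s hs).1⟩] at this
    simp at this

lemma stabilizer_cell {v : V} (hv : ∀ s, 0 ≤ D.form v (D.basis s))
    {I : Set S} (hI : D.IsAdm v I) :
    MulAction.stabilizer G (D.cell v I) = D.parab (D.closureSet v I) := by
  ext g
  exact ⟨fun h => (mem_parab_closureSet_of_smul_cell_eq hv hI hI h).1,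
    smul_cell_of_mem_closureSet⟩

lemma eq_of_mem_orbit {v : V} (hv : ∀ s, 0 ≤ D.form v (D.basis s))
    {I I' : Set S} (hI : D.IsAdm v I) (hI' : D.IsAdm v I') {F : Set V}
    (h : F ∈ MulAction.orbit G (D.cell v I)) (h' : F ∈ MulAction.orbit G (D.cell v I')) :
    I = I' := by
  obtain ⟨g, rfl⟩ := h
  obtain ⟨g', h'⟩ := h'
  simp only at h'
  refine Set.Subset.antisymm
    (mem_parab_closureSet_of_smul_cell_eq hv hI hI' (g := g'⁻¹ * g) ?_).2
    (mem_parab_closureSet_of_smul_cell_eq hv hI' hI (g := g⁻¹ * g') ?_).2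
  · rw [mul_smul, ← h', inv_smul_smul]
  · rw [mul_smul, h', inv_smul_smul]

/-! ### Face numbers and the `h`-polynomial -/

lemma ncard_orbit_cell {v : V} (hv : ∀ s, 0 ≤ D.form v (D.basis s))
    {I : Set S} (hI : D.IsAdm v I) :
    ((MulAction.orbit G (D.cell v I)).ncard : ℚ) =
      Nat.card G / Nat.card (D.parab (D.closureSet v I)) := by
  rw [← stabilizer_cell hv hI, eq_div_iff (by exact_mod_cast Nat.card_pos.ne'),
    ← Nat.card_coe_set_eq]
  classical
  have := Fintype.ofFinite G
  have : Finite (MulAction.orbit G (D.cell v I)) := (Set.finite_range _).to_subtype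
  have := Fintype.ofFinite (MulAction.orbit G (D.cell v I))
  have := Fintype.ofFinite (MulAction.stabilizer G (D.cell v I))
  simp only [Nat.card_eq_fintype_card]
  exact_mod_cast MulAction.card_orbit_mul_card_stabilizer_eq_card_group G (D.cell v I)

open Classical in
lemma faceNumber_eq {v : V} (hv : ∀ s, 0 ≤ D.form v (D.basis s)) (i : ℕ) :
    (faceNumber (convexHull ℚ (Set.range fun h : G => h • v)) i : ℚ) =
      ∑ I ∈ Finset.univ.filter fun I : Finset S => D.IsAdm v I ∧ I.card = i,
        (Nat.card G : ℚ) / Nat.card (D.parab (D.closureSet v (I : Set S))) := by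
  have hfin : ∀ I : Finset S, (MulAction.orbit G (D.cell v (I : Set S))).Finite :=
    fun I => Set.finite_range _
  have hset : {F | IsFace (convexHull ℚ (Set.range fun h : G => h • v)) F ∧ dim F = i} =
      ((Finset.univ.filter fun I : Finset S => D.IsAdm v I ∧ I.card = i).biUnion
        fun I => (hfin I).toFinset : Finset (Set V)) := by
    ext F
    simp only [Set.mem_ofPred_eq, isFace_iff_isAdm (D := D) hv, Finset.coe_biUnion,
      Finset.coe_filter, Finset.mem_univ, true_and, Set.mem_iUnion, Set.Finite.coe_toFinset,
      exists_prop]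
    constructor
    · rintro ⟨⟨I, hI, hF⟩, rfl⟩
      refine ⟨I, ⟨hI, ?_⟩, hF⟩
      obtain ⟨g, rfl⟩ := hF
      exact (dim_smul g _).trans (dim_cell hI) |>.symm
    · rintro ⟨I, ⟨hI, rfl⟩, hF⟩
      refine ⟨⟨I, hI, hF⟩, ?_⟩
      obtain ⟨g, rfl⟩ := hF
      exact (dim_smul g _).trans (dim_cell hI)
  rw [faceNumber, hset, Set.ncard_coe_finset, Finset.card_biUnion, Nat.cast_sum]
  · refine Finset.sum_congr rfl fun I hI => ?_
    rw [← ncard_orbit_cell hv (Finset.mem_filter.1 hI).2.1, Set.ncard_eq_toFinset_card _ (hfin I)]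
  · intro I hI I' hI' hne
    rw [Function.onFun, Finset.disjoint_left]
    intro F hF hF'
    rw [Set.Finite.mem_toFinset] at hF hF'
    exact hne (Finset.coe_injective (eq_of_mem_orbit hv (Finset.mem_filter.1 hI).2.1
      (Finset.mem_filter.1 hI').2.1 hF hF'))

-- Ensures that the truncation of the face polynomial at the dimension of the polytope loses no
-- admissible set.
omit [Finite G] in
lemma card_le_dim {v : V} {I : Finset S} (hI : D.IsAdm v I) :
    I.card ≤ dim (convexHull ℚ (Set.range fun h : G => h • v)) := by
  have : Module.Finite ℚ V := Module.Finite.of_basis D.basis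
  rw [← dim_cell hI]
  exact Submodule.finrank_mono (vectorSpan_mono ℚ (convexHull_mono (Set.image_subset_range _ _)))

open Classical in
/-- The `h`-polynomial of the orbit polytope of a dominant vector. -/
theorem hPolynomial_eq {v : V} (hv : ∀ s, 0 ≤ D.form v (D.basis s)) :
    hPolynomial (convexHull ℚ (Set.range fun h : G => h • v)) =
      ∑ I ∈ Finset.univ.filter fun I : Finset S => D.IsAdm v I,
        Polynomial.C ((Nat.card G : ℚ) / Nat.card (D.parab (D.closureSet v (I : Set S)))) *
          (Polynomial.X - 1) ^ I.card := by
  rw [hPolynomial, facePolynomial, Polynomial.sum_comp,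
    ← Finset.sum_fiberwise_of_maps_to (g := Finset.card)
      (t := Finset.range (dim (convexHull ℚ (Set.range fun h : G => h • v)) + 1))]
  · refine Finset.sum_congr rfl fun i _ => ?_
    rw [faceNumber_eq hv, Polynomial.mul_comp, Polynomial.C_comp, Polynomial.X_pow_comp,
      map_sum, Finset.sum_mul, Finset.filter_filter]
    exact Finset.sum_congr rfl fun I hI => by rw [(Finset.mem_filter.1 hI).2.2]
  · intro I hI
    rw [Finset.mem_range, Nat.lt_succ_iff]
    exact card_le_dim (Finset.mem_filter.1 hI).2

end SimpleSystem

/-! ### The Weyl group of a root system as a `SimpleSystem` -/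

section RootSystem

variable {ι M N : Type*} [AddCommGroup M] [Module ℚ M] [AddCommGroup N] [Module ℚ N]
  {P : RootPairing ι ℚ M N}

namespace RootPairing

lemma weylGroup_ext {g h : P.weylGroup} (H : ∀ x : M, g • x = h • x) : g = h :=
  Subtype.ext (Equiv.weightHom_injective P (LinearEquiv.ext H))

lemma finite_weylGroup [Finite ι] [P.IsRootSystem] : Finite P.weylGroup := by
  refine Finite.of_injective P.weylGroupToPerm fun g h hgh => weylGroup_ext fun x => ?_
  have hx : x ∈ Submodule.span ℚ (Set.range P.root) := by
    rw [IsRootSystem.span_root_eq_top]; trivial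
  induction hx using Submodule.span_induction with
  | mem x hx =>
    obtain ⟨i, rfl⟩ := hx
    rw [weylGroup_apply_root, weylGroup_apply_root, hgh]
  | zero => simp
  | add x y _ _ hx hy => rw [smul_add, smul_add, hx, hy]
  | smul q x _ hx => rw [smul_comm, hx, smul_comm]

lemma rootForm_self_pos [Fintype ι] [P.IsRootSystem] [P.IsCrystallographic] {x : M} (hx : x ≠ 0) :
    0 < P.RootForm x x := by
  refine lt_of_le_of_ne ?_ fun h => hx ?_
  · rw [rootForm_apply_apply]
    exact Finset.sum_nonneg fun i _ => mul_self_nonneg _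
  · rw [eq_comm, rootForm_apply_apply,
      Finset.sum_eq_zero_iff_of_nonneg fun i _ => mul_self_nonneg _] at h
    refine P.rootForm_nondegenerate.1 x fun y => ?_
    rw [rootForm_apply_apply]
    exact Finset.sum_eq_zero fun i hi => by rw [mul_self_eq_zero.1 (h i hi), zero_mul]

lemma rootForm_root_mul_coroot' [Fintype ι] (i : ι) (x : M) :
    P.RootForm (P.root i) (P.root i) * P.toLinearMap x (P.coroot i) =
      2 * P.RootForm x (P.root i) := by
  have h := congrArg (P.toLinearMap x) (P.rootForm_self_smul_coroot i)
  rw [map_smul, smul_eq_mul, map_nsmul, toLinearMap_apply_apply_Polarization] at h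
  rw [h, P.rootForm_symmetric.eq (P.root i) x |>.symm, nsmul_eq_mul]
  simp

lemma reflection_mem_closure_simple [Finite ι] [P.IsCrystallographic] [P.IsReduced] (b : P.Base)
    (i : ι) : weylGroup.ofIdx P i ∈
      Subgroup.closure (Set.range fun s : b.support => weylGroup.ofIdx P s) := by
  refine b.induction_reflect i (p := fun i => weylGroup.ofIdx P i ∈
    Subgroup.closure (Set.range fun s : b.support => weylGroup.ofIdx P s)) ?_ ?_ ?_
  · intro i hi
    have : weylGroup.ofIdx P (P.reflectionPerm i i) = weylGroup.ofIdx P i :=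
      weylGroup_ext fun x => by simp [reflection_apply, two_smul]
    rwa [this]
  · exact fun i hi => Subgroup.subset_closure ⟨⟨i, hi⟩, rfl⟩
  · intro i j hi hj
    have : weylGroup.ofIdx P (P.reflectionPerm j i) =
        weylGroup.ofIdx P j * weylGroup.ofIdx P i * weylGroup.ofIdx P j :=
      weylGroup_ext fun x => by
        simp [mul_smul, reflection_reflectionPerm]
    rw [this]
    have hj' : weylGroup.ofIdx P j ∈
        Subgroup.closure (Set.range fun s : b.support => weylGroup.ofIdx P s) :=
      Subgroup.subset_closure ⟨⟨j, hj⟩, rfl⟩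
    exact mul_mem (mul_mem hj' hi) hj'

lemma closure_simple_eq_top [Finite ι] [P.IsCrystallographic] [P.IsReduced] (b : P.Base) :
    Subgroup.closure (Set.range (simpleReflection b)) = ⊤ := by
  rw [eq_top_iff]
  rintro ⟨g, hg⟩ -
  induction hg using weylGroup.induction with
  | mem i => exact reflection_mem_closure_simple b i
  | one => exact one_mem _
  | mul g h hg hh h1 h2 => exact mul_mem h1 h2

end RootPairing

namespace RootPairing.Base

variable [Fintype ι] [P.IsRootSystem] [P.IsCrystallographic] [P.IsReduced]

/-- The Weyl group with its simple reflections, acting on the weight space. -/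
noncomputable def simpleSystem (b : P.Base) : SimpleSystem P.weylGroup M b.support where
  basis := b.toWeightBasis
  form := P.RootForm
  form_comm x y := (P.rootForm_symmetric.eq x y)
  form_pos _ := rootForm_self_pos
  form_smul g x y := InvariantForm.apply_weylGroup_smul (B := P.toInvariantForm) P g x y
  refl := simpleReflection b
  refl_smul s x := by
    rw [b.toWeightBasis_apply, simpleReflection, weylGroup.ofIdx_smul, Equiv.reflection_smul,
      reflection_apply, ← rootForm_root_mul_coroot',
      mul_div_cancel_left₀ _ (rootForm_self_pos (P.ne_zero s)).ne']
    rfl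
  closure_refl := closure_simple_eq_top b
  eq_one_of_smul g hg := weylGroup_ext fun x => by rw [hg, one_smul]
  pos := {x | ∃ i, b.IsPos i ∧ P.root i = x}
  basis_mem_pos s := ⟨s, isPos_of_mem_support s.2, (b.toWeightBasis_apply s).symm⟩
  repr_nonneg_of_mem_pos := by
    rintro _ ⟨i, hi, rfl⟩
    refine hi.induction_on_add (p := fun i => ∀ s, 0 ≤ b.toWeightBasis.repr (P.root i) s) ?_ ?_
    · intro i hi s
      rw [b.toWeightBasis_repr_root ⟨i, hi⟩]
      exact Finsupp.single_nonneg.2 zero_le_one s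
    · intro i j k hk hi hj s
      rw [hk, map_add, b.toWeightBasis_repr_root ⟨j, hj⟩]
      exact add_nonneg (hi s) (Finsupp.single_nonneg.2 zero_le_one s)
  refl_smul_mem_pos := by
    rintro s _ ⟨i, hi, rfl⟩ hne
    refine ⟨P.reflectionPerm s i, hi.reflectionPerm s.2 fun h => hne ?_, ?_⟩
    · rw [h, b.toWeightBasis_apply]
    · rw [root_reflectionPerm]; rfl
  smul_basis_mem_pos_or g s := by
    let := P.indexNeg
    rw [b.toWeightBasis_apply, weylGroup_apply_root]
    rcases IsPos.or_neg b (P.weylGroupToPerm g s) with h | h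
    · exact Or.inl ⟨_, h, rfl⟩
    · exact Or.inr ⟨_, h, by rw [indexNeg_neg, root_reflectionPerm, reflection_apply_self]⟩

variable {b : P.Base}

/-- If the reflections commute, the reflection in s negates the image under t of the root of s.
Comparing coordinates at t shows that the Cartan coefficient c vanishes. Conversely, orthogonality
means that s fixes the root of t, hence commutes with its reflection. -/
lemma simpleSystem_commute_iff {s t : b.support} (h : s ≠ t) :
    Commute (simpleReflection b s) (simpleReflection b t) ↔
      b.simpleSystem.form (b.simpleSystem.basis s) (b.simpleSystem.basis t) = 0 := by
  set D := b.simpleSystem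
  change D.refl s * D.refl t = D.refl t * D.refl s ↔ _
  constructor
  · intro hc
    rw [← SimpleSystem.refl_smul_eq_self_iff]
    have h1 : D.refl s • D.refl t • D.basis s = -(D.refl t • D.basis s) := by
      rw [← mul_smul, hc, mul_smul, SimpleSystem.refl_smul_basis, smul_neg]
    rw [D.refl_smul t] at h1 ⊢
    set c := 2 * D.form (D.basis s) (D.basis t) / D.form (D.basis t) (D.basis t)
    have h2 := congrArg (fun x => D.basis.repr x t) h1
    simp only [D.refl_smul s, map_sub, map_smul, map_neg, Module.Basis.repr_self,
      Finsupp.coe_sub, Finsupp.coe_smul, Finsupp.coe_neg, Pi.sub_apply, Pi.smul_apply,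
      Pi.neg_apply, Finsupp.single_eq_same, smul_eq_mul, Finsupp.single_eq_of_ne' h] at h2
    have h3 : c = 0 := by linarith
    rw [h3, zero_smul, sub_zero]
  · intro h0
    refine SimpleSystem.conj_refl ?_
    rw [D.form_comm] at h0
    exact SimpleSystem.refl_smul_eq_self_iff.2 h0

lemma coe_star {J : Finset b.support} {lam : M}
    (hJ : ∀ s : b.support, s ∈ J ↔ simpleReflection b s • lam = lam) (I : Finset b.support) :
    (star b J I : Set b.support) = b.simpleSystem.closureSet lam I := by
  ext s
  by_cases hs : s ∈ I
  · simp [WeylPolytope.star, SimpleSystem.closureSet, hs]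
  · have h1 : s ∈ J ↔ b.simpleSystem.form lam (b.simpleSystem.basis s) = 0 :=
      (hJ s).trans (SimpleSystem.refl_smul_eq_self_iff (D := b.simpleSystem))
    have h2 : (∀ t ∈ I, Commute (simpleReflection b s) (simpleReflection b t)) ↔
        ∀ t ∈ I, b.simpleSystem.form (b.simpleSystem.basis s) (b.simpleSystem.basis t) = 0 :=
      forall₂_congr fun t ht => simpleSystem_commute_iff fun h => hs (h ▸ ht)
    simpa [WeylPolytope.star, SimpleSystem.closureSet, hs, h1] using fun _ => by simpa using h2

/-- A part of I orthogonal to the rest is a union of connected components. So a nonempty one inside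
J contains, by induction along paths, a whole component, and conversely each component is such a
part. -/
lemma mem_admissible_iff {J : Finset b.support} {lam : M}
    (hJ : ∀ s : b.support, s ∈ J ↔ simpleReflection b s • lam = lam) (I : Finset b.support) :
    I ∈ admissible b J ↔ b.simpleSystem.IsAdm lam I := by
  have hJ' : ∀ s, s ∈ J ↔ b.simpleSystem.form lam (b.simpleSystem.basis s) = 0 := fun s =>
    (hJ s).trans (SimpleSystem.refl_smul_eq_self_iff (D := b.simpleSystem))
  simp only [admissible, Finset.mem_filter, Finset.mem_univ, true_and]
  constructor
  · intro h A hAI hAJ hA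
    by_contra! hne
    obtain ⟨s, hs⟩ := hne
    refine h (SimpleGraph.connectedComponentMk _ ⟨s, hAI hs⟩) fun t ht => (hJ' _).2 (hAJ _ ?_)
    have hst := (SimpleGraph.reachable_iff_reflTransGen _ _).1
      (SimpleGraph.ConnectedComponent.exact ht).symm
    induction hst with
    | refl => exact hs
    | @tail t u _ htu ih =>
      have ht := ih (SimpleGraph.ConnectedComponent.sound
        ((SimpleGraph.reachable_iff_reflTransGen _ _).2 ‹_›).symm)
      by_contra hu
      refine htu ((simpleSystem_commute_iff fun h => hu ?_).2 (hA _ ht _ ⟨u.2, hu⟩))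
      have h : t.1 = u.1 := h
      rwa [← h]
  · intro h c hc
    obtain ⟨s, hs⟩ := c.nonempty_supp
    have hA := h (Subtype.val '' c.supp) (by rintro _ ⟨t, -, rfl⟩; exact t.2)
      (by rintro _ ⟨t, ht, rfl⟩; exact (hJ' _).1 (hc t ht)) ?_
    · exact (hA ▸ Set.mem_image_of_mem _ hs : s.1 ∈ (∅ : Set b.support))
    · rintro _ ⟨t, ht, rfl⟩ u ⟨huI, hu⟩
      have htu : t.1 ≠ u := fun h => hu ⟨t, ht, h⟩
      rw [← simpleSystem_commute_iff htu]
      by_contra hnc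
      refine hu ⟨⟨u, huI⟩, ?_, rfl⟩
      exact c.mem_supp_of_adj_mem_supp ht hnc

lemma simpleSystem_form_nonneg {lam : M} (h : IsDominant b lam) (s : b.support) :
    0 ≤ b.simpleSystem.form lam (b.simpleSystem.basis s) := by
  have h1 := rootForm_root_mul_coroot' (P := P) s lam
  have h2 := mul_nonneg (rootForm_self_pos (P := P) (P.ne_zero s)).le (h s)
  change 0 ≤ P.RootForm lam (b.toWeightBasis s)
  rw [b.toWeightBasis_apply]
  linarith

end RootPairing.Base

end RootSystem

theorem corollary1 {ι M N : Type*} [Finite ι]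
    [AddCommGroup M] [Module ℚ M] [AddCommGroup N] [Module ℚ N]
    (P : RootPairing ι ℚ M N) [P.IsRootSystem] [P.IsCrystallographic] [P.IsReduced]
    (b : P.Base) (J : Finset b.support) (lam : M)
    (hdom : WeylPolytope.IsDominant b lam)
    (hJ : ∀ s : b.support, s ∈ J ↔ WeylPolytope.simpleReflection b s • lam = lam) :
    WeylPolytope.hPolynomial (WeylPolytope.weightPolytope P lam) =
      ∑ I ∈ WeylPolytope.admissible b J,
        Polynomial.C ((Nat.card P.weylGroup : ℚ) /
            (Nat.card (WeylPolytope.parabolic b (WeylPolytope.star b J I)) : ℚ)) *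
          (Polynomial.X - 1) ^ I.card := by
  classical
  have := Fintype.ofFinite ι
  have := RootPairing.finite_weylGroup (P := P)
  refine (SimpleSystem.hPolynomial_eq (D := b.simpleSystem)
    (RootPairing.Base.simpleSystem_form_nonneg hdom)).trans
      (Finset.sum_congr ?_ fun I _ => ?_)
  · ext I
    rw [RootPairing.Base.mem_admissible_iff hJ, Finset.mem_filter]
    exact and_iff_right (Finset.mem_univ I)
  · rw [← RootPairing.Base.coe_star hJ]
    rfl
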